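/- Let $(R,\mathfrak m)$ be a Cohen--Macaulay (Noetherian) local ring of dimension $d$, and let $I_1, I_2$ be $\mathfrak m$-primary ideals of $R$. Let $F=F_{I_1}(I_2)=\bigoplus_{n\ge 0} I_2^n/I_1I_2^n$ be the fiber cone of $I_2$ with respect to $I_1$. Let $H(F,n)=\ell_R(I_2^n/I_1I_2^n)$ for $n\ge 0$ and $H(F,n)=0$ for $n<0$. These lengths and $\ell(R/I_1)$ are finite, and there are a unique polynomial $P(F,n)\in\mathbb Q[n]$ with $P(F,n)=H(F,n)$ for all $n\gg 0$, and unique integers $f_{i,I_1}(I_2)$, $0\le i\le d-1$ (the Hilbert coefficients of $F$), such that $$P(F,n)=\sum_{i=0}^{d-1}(-1)^i f_{i,I_1}(I_2)\binom{n+d-1-i}{d-1-i}.$$ For $g:\mathbb Z\to\mathbb Q$ put $(\Delta g)(n)=g(n)-g(n-1)$. Then for every $i$ with $1\le i\le d-1$ the following hold (the sums have only finitely many nonzero terms): 1. $\displaystyle f_{i,I_1}(I_2)=\sum_{n\ge i-1}\binom{n}{i-1}\,\Delta^{d-1}\bigl[P(F,n)-H(F,n)\bigr];$ 2. $\displaystyle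 (-1)^i\sum_{j=0}^{i}(-1)^j f_{j,I_1}(I_2)+(-1)^{i+1}\ell(R/I_1)=\sum_{n\ge i}\binom{n-1}{i-1}\,\Delta^{d-1}\bigl[P(F,n)-H(F,n)\bigr].$ -/

import Mathlib

open Filter Polynomial

namespace FiberCone

/-- A Noetherian local ring is Cohen-Macaulay if its maximal ideal contains a regular sequence
whose length is the Krull dimension of the ring. -/
def IsCohenMacaulayLocal (R : Type*) [CommRing R] [IsLocalRing R] : Prop :=
  ∃ rs : List R, (∀ r ∈ rs, r ∈ IsLocalRing.maximalIdeal R) ∧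
    RingTheory.Sequence.IsRegular R rs ∧ (rs.length : WithBot ℕ∞) = ringKrullDim R

variable {R : Type*} [CommRing R]

/-- The degree `n` component `I₂ ^ n / I₁ I₂ ^ n` of the fiber cone
`F_{I₁}(I₂) = ⨁_{n ≥ 0} I₂ ^ n / I₁ I₂ ^ n` of `I₂` with respect to `I₁`. -/
abbrev component (I₁ I₂ : Ideal R) (n : ℕ) : Type _ :=
  ↥(I₂ ^ n) ⧸ (I₁ * I₂ ^ n).submoduleOf (I₂ ^ n)

/-- The Hilbert function `n ↦ H(F_{I₁}(I₂), n)`: the length over `R` of the degree `n` component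
of the fiber cone, for every integer `n`. The fiber cone has no components of negative degree. -/
noncomputable def hilbertFunction (I₁ I₂ : Ideal R) (n : ℤ) : ℕ :=
  if 0 ≤ n then (Module.length R (component I₁ I₂ n.toNat)).toNat else 0

/-- `P` is the Hilbert polynomial of the fiber cone: it agrees with the Hilbert function at all
sufficiently large integers. There is at most one such polynomial. -/
def IsHilbertPolynomial (I₁ I₂ : Ideal R) (P : ℚ[X]) : Prop :=
  ∀ᶠ n : ℤ in atTop, P.eval (n : ℚ) = (hilbertFunction I₁ I₂ n : ℚ)

open Classical in
/-- The Hilbert polynomial `P(F_{I₁}(I₂), n)` of the fiber cone (`0` if there is none). -/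
noncomputable def hilbertPolynomial (I₁ I₂ : Ideal R) : ℚ[X] :=
  if h : ∃ P : ℚ[X], IsHilbertPolynomial I₁ I₂ P then h.choose else 0

/-- The integers `f 0, …, f (d - 1)` are the coefficients of the polynomial `P` in
`P(n) = ∑_{i < d} (-1) ^ i f i (n + d - 1 - i choose d - 1 - i)`. The polynomial
`preHilbertPoly ℚ k 0` is `(X + k) (X + k - 1) ⋯ (X + 1) / k!`, that is, `(n + k choose k)`. -/
def IsCoefficientSequence (d : ℕ) (P : ℚ[X]) (f : Fin d → ℤ) : Prop :=
  P = ∑ i : Fin d, ((-1) ^ (i : ℕ) * (f i : ℚ)) • preHilbertPoly ℚ (d - 1 - i) 0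

open Classical in
/-- The Hilbert coefficients `f_{i, I₁}(I₂)`, for `i < d`, of the fiber cone of a local ring of
dimension `d` (`0` if there are none). -/
noncomputable def hilbertCoefficient (d : ℕ) (I₁ I₂ : Ideal R) : Fin d → ℤ :=
  if h : ∃ f : Fin d → ℤ, IsCoefficientSequence d (hilbertPolynomial I₁ I₂) f
  then h.choose else 0

/-- The backward difference operator `(Δ g)(n) = g(n) - g(n - 1)`. -/
def Δ (g : ℤ → ℚ) (n : ℤ) : ℚ := g n - g (n - 1)

/-- The function `n ↦ P(F_{I₁}(I₂), n) - H(F_{I₁}(I₂), n)` on the integers. -/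
noncomputable def defect (I₁ I₂ : Ideal R) (n : ℤ) : ℚ :=
  (hilbertPolynomial I₁ I₂).eval (n : ℚ) - (hilbertFunction I₁ I₂ n : ℚ)

end FiberCone

/-! Everything follows once the Hilbert series of the fiber cone is written as `h(X) / (1 - X)^d`
with `h` an integer polynomial. Write `h_k` for the coefficients of `h`.

Expanding `h` in powers of `1 - X` gives `f_i = ∑ h_k (k choose i)`. The term `h_k X^k` contributes
`h_k (n - k + d - 1 choose d - 1)` to `P` for all `n`, but to `H` only for `n ≥ k`. Hence `Δ^(d-1)
(P - H)(n) = ∑_{k > n} h_k`. Exchanging sums leaves two binomial identities: `sum_Ico_choose` for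
the first formula and `sum_Ico_choose_pred` for the second, where the exceptional index `k = 0`
produces `h_0 = ℓ(R/I₁)`.

Rationality is a Hilbert–Serre argument on a presentation of the fiber cone
(`hasRationalSeries_gradedLength`). The pole order at `1` is at most `d` because `I₂^s ⊆ I₁` for
some `s`: the lengths along multiples of `s` telescope below `ℓ(R/I₂^(sN))`, which is `O(N^d)` by
comparison with a parameter ideal (`exists_sum_length_component_le`, `exists_mul_eq_of_sum_le`). -/

namespace FiberCone

/-! ### Lengths of quotients by powers of ideals -/

section Length

variable {R : Type*} [CommRing R]

/-- Additivity along `0 → A/f⁻¹(N) → B/N → B/(N + im f) → 0`; the source of every length recursion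
below. -/
theorem length_quotient_eq_add {A B : Type*} [AddCommGroup A] [Module R A] [AddCommGroup B]
    [Module R B] (f : A →ₗ[R] B) (N : Submodule R B) :
    Module.length R (B ⧸ N) =
      Module.length R (A ⧸ N.comap f) + Module.length R (B ⧸ (N ⊔ LinearMap.range f)) := by
  refine Module.length_eq_add_of_exact (Submodule.mapQ (N.comap f) N f le_rfl)
    (Submodule.factor (le_sup_left : N ≤ N ⊔ LinearMap.range f)) ?_ ?_ ?_
  · rw [← LinearMap.ker_eq_bot, Submodule.mapQ, Submodule.ker_liftQ_eq_bot]
    intro x hx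
    simpa using hx
  · exact Submodule.factor_surjective _
  · intro y
    obtain ⟨y, rfl⟩ := N.mkQ_surjective y
    change Submodule.Quotient.mk (p := N ⊔ LinearMap.range f) y = 0 ↔ _
    rw [Submodule.Quotient.mk_eq_zero, Set.mem_range]
    constructor
    · intro hy
      obtain ⟨z, hz, w, ⟨a, rfl⟩, rfl⟩ := Submodule.mem_sup.1 hy
      refine ⟨Submodule.Quotient.mk a, ?_⟩
      rw [Submodule.mapQ_apply, eq_comm, Submodule.mkQ_apply, Submodule.Quotient.eq]
      simpa using hz
    · rintro ⟨a, ha⟩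
      obtain ⟨a, rfl⟩ := Submodule.mkQ_surjective _ a
      rw [Submodule.mkQ_apply, Submodule.mapQ_apply, eq_comm, Submodule.mkQ_apply,
        Submodule.Quotient.eq] at ha
      exact Submodule.mem_sup.2 ⟨y - f a, ha, f a, LinearMap.mem_range_self f a, by abel⟩

theorem length_quotient_eq_of_surjective {A B : Type*} [AddCommGroup A] [Module R A]
    [AddCommGroup B] [Module R B] (f : A →ₗ[R] B) (hf : Function.Surjective f)
    (N : Submodule R B) :
    Module.length R (B ⧸ N) = Module.length R (A ⧸ N.comap f) := by
  have : Subsingleton (B ⧸ (N ⊔ LinearMap.range f)) := by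
    rw [Submodule.Quotient.subsingleton_iff, LinearMap.range_eq_top.2 hf, sup_top_eq]
  rw [length_quotient_eq_add f N, Module.length_eq_zero (M := B ⧸ (N ⊔ LinearMap.range f)),
    add_zero]

theorem length_quotient_anti {B : Type*} [AddCommGroup B] [Module R B] {N M : Submodule R B}
    (h : N ≤ M) : Module.length R (B ⧸ M) ≤ Module.length R (B ⧸ N) :=
  Module.length_le_of_surjective (Submodule.factor h) (Submodule.factor_surjective h)

/-- Apply the exact sequence to multiplication by `a`: the preimage of `J + (ab)` contains `J +
(b)`, and the cokernel is a quotient of `R/(J + (a))`. -/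
theorem length_quotient_sup_span_mul_le (J : Ideal R) (a b : R) :
    Module.length R (R ⧸ (J ⊔ Ideal.span {a * b})) ≤
      Module.length R (R ⧸ (J ⊔ Ideal.span {a})) + Module.length R (R ⧸ (J ⊔ Ideal.span {b})) := by
  rw [add_comm, length_quotient_eq_add (LinearMap.mulLeft R a) (J ⊔ Ideal.span {a * b})]
  gcongr
  · refine length_quotient_anti (sup_le ?_ ?_)
    · intro x hx
      exact Ideal.mem_sup_left (J.mul_mem_left a hx)
    · rw [Ideal.span_singleton_le_iff_mem]
      exact Ideal.mem_sup_right (Ideal.mem_span_singleton_self _)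
  · refine length_quotient_anti (sup_le (le_sup_left.trans le_sup_left) ?_)
    rw [Ideal.span_singleton_le_iff_mem]
    exact Submodule.mem_sup_right ⟨1, by simp⟩

theorem length_quotient_sup_span_pow_le (J : Ideal R) (a : R) (n : ℕ) :
    Module.length R (R ⧸ (J ⊔ Ideal.span {a ^ n})) ≤
      n * Module.length R (R ⧸ (J ⊔ Ideal.span {a})) := by
  induction n with
  | zero =>
    have : Subsingleton (R ⧸ (J ⊔ Ideal.span {a ^ 0})) := by
      rw [Ideal.Quotient.subsingleton_iff]; simp
    rw [Module.length_eq_zero]; simp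
  | succ n ih =>
    rw [pow_succ]
    refine (length_quotient_sup_span_mul_le J _ _).trans ?_
    push_cast
    rw [add_mul, one_mul]
    gcongr

/-- Generators are replaced by their powers one at a time, each at the cost of a factor `n`; the
arbitrary `J` absorbs the other generators. -/
theorem length_quotient_sup_span_image_pow_le (s : Finset R) (J : Ideal R) (n : ℕ) :
    Module.length R (R ⧸ (J ⊔ Ideal.span ((· ^ n) '' (s : Set R)))) ≤
      (n : ℕ∞) ^ s.card * Module.length R (R ⧸ (J ⊔ Ideal.span (s : Set R))) := by
  classical
  induction s using Finset.induction_on generalizing J with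
  | empty =>
    rw [Finset.card_empty, pow_zero, one_mul]
    refine length_quotient_anti (sup_le_sup_left (Ideal.span_mono ?_) J)
    simp
  | insert a s ha ih =>
    rw [Finset.coe_insert, Set.image_insert_eq, Ideal.span_insert, Ideal.span_insert,
      Finset.card_insert_of_notMem ha, ← sup_assoc, ← sup_assoc]
    calc _ ≤ (n : ℕ∞) ^ s.card * _ := ih (J ⊔ Ideal.span {a ^ n})
      _ ≤ (n : ℕ∞) ^ s.card * (n * _) := by
        rw [sup_right_comm]
        exact mul_le_mul_right (length_quotient_sup_span_pow_le (J ⊔ Ideal.span (s : Set R)) a n) _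
      _ = _ := by rw [pow_succ, mul_assoc, sup_right_comm]

theorem length_quotient_span_pow_le (s : Finset R) (n : ℕ) :
    Module.length R (R ⧸ Ideal.span (s : Set R) ^ n) ≤
      (n : ℕ∞) ^ s.card * Module.length R (R ⧸ Ideal.span (s : Set R)) := by
  have h := length_quotient_sup_span_image_pow_le s ⊥ n
  rw [bot_sup_eq, bot_sup_eq] at h
  refine (length_quotient_anti ?_).trans h
  rw [Ideal.span_le]
  rintro _ ⟨x, hx, rfl⟩
  exact Ideal.pow_mem_pow (Ideal.subset_span hx) n

end Length

/-! ### Hilbert–Serre theorem for graded quotients of a polynomial ring -/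

section HilbertSerre

open MvPolynomial

variable {R σ : Type*} [CommRing R]

/-- The length of the degree `n` component of `R[σ] / J`, for a homogeneous ideal `J`. -/
noncomputable def gradedLength (J : Ideal (MvPolynomial σ R)) (n : ℕ) : ℕ∞ :=
  Module.length R (homogeneousSubmodule σ R n ⧸
    (J.restrictScalars R).comap (homogeneousSubmodule σ R n).subtype)

/-- An ideal of a polynomial ring that contains the homogeneous components of its elements. -/
def IsGradedIdeal (J : Ideal (MvPolynomial σ R)) : Prop :=
  ∀ p ∈ J, ∀ n, homogeneousComponent n p ∈ J

theorem gradedLength_anti {J K : Ideal (MvPolynomial σ R)} (h : J ≤ K) (n : ℕ) :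
    gradedLength K n ≤ gradedLength J n :=
  length_quotient_anti (Submodule.comap_mono h)

theorem homogeneousComponent_succ_X_mul (i : σ) (p : MvPolynomial σ R) (n : ℕ) :
    homogeneousComponent (n + 1) (X i * p) = X i * homogeneousComponent n p := by
  classical
  ext m
  rw [coeff_homogeneousComponent, coeff_X_mul', coeff_X_mul', coeff_homogeneousComponent]
  by_cases hi : i ∈ m.support
  · have : (m - Finsupp.single i 1).degree + 1 = m.degree := by
      have h1 : m - Finsupp.single i 1 + Finsupp.single i 1 = m :=
        tsub_add_cancel_of_le (by
          rw [Finsupp.single_le_iff]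
          exact Nat.one_le_iff_ne_zero.2 (Finsupp.mem_support_iff.1 hi))
      conv_rhs => rw [← h1]
      simp
    simp only [hi, if_true, ← this, add_left_inj]
  · simp [hi]

theorem homogeneousComponent_zero_X_mul (i : σ) (p : MvPolynomial σ R) :
    homogeneousComponent 0 (X i * p) = 0 := by
  rw [homogeneousComponent_zero, ← constantCoeff_eq]
  simp

/-- The ideal quotient `J : X i`. -/
noncomputable def colonX (J : Ideal (MvPolynomial σ R)) (i : σ) : Ideal (MvPolynomial σ R) :=
  Submodule.comap (LinearMap.mulLeft (MvPolynomial σ R) (X i)) J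

theorem mem_colonX {J : Ideal (MvPolynomial σ R)} {i : σ} {p : MvPolynomial σ R} :
    p ∈ colonX J i ↔ X i * p ∈ J := Iff.rfl

theorem le_colonX (J : Ideal (MvPolynomial σ R)) (i : σ) : J ≤ colonX J i :=
  fun _ hp => J.mul_mem_left _ hp

theorem IsGradedIdeal.colonX {J : Ideal (MvPolynomial σ R)} (hJ : IsGradedIdeal J) (i : σ) :
    IsGradedIdeal (colonX J i) := by
  intro p hp n
  rw [mem_colonX, ← homogeneousComponent_succ_X_mul]
  exact hJ _ hp _

theorem IsGradedIdeal.sup_span_X {J : Ideal (MvPolynomial σ R)} (hJ : IsGradedIdeal J) (i : σ) :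
    IsGradedIdeal (J ⊔ Ideal.span {X i}) := by
  intro p hp n
  obtain ⟨j, hj, w, hw, rfl⟩ := Submodule.mem_sup.1 hp
  obtain ⟨q, rfl⟩ := Ideal.mem_span_singleton.1 hw
  rw [map_add]
  refine add_mem (Ideal.mem_sup_left (hJ _ hj _)) (Ideal.mem_sup_right ?_)
  rw [Ideal.mem_span_singleton]
  cases n with
  | zero => rw [homogeneousComponent_zero_X_mul]; exact dvd_zero _
  | succ n => rw [homogeneousComponent_succ_X_mul]; exact dvd_mul_right _ _

/-- This is the degree `n + 1` part of `0 → (S/(J : X_i))(-1) → S/J → S/(J + (X_i)) → 0`. Gradedness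
of `J` allows a decomposition in `J + (X_i)` to be replaced by its homogeneous part. -/
theorem gradedLength_succ {J : Ideal (MvPolynomial σ R)} (hJ : IsGradedIdeal J) (i : σ) (n : ℕ) :
    gradedLength J (n + 1) =
      gradedLength (colonX J i) n + gradedLength (J ⊔ Ideal.span {X i}) (n + 1) := by
  let f : homogeneousSubmodule σ R n →ₗ[R] homogeneousSubmodule σ R (n + 1) :=
    (LinearMap.mulLeft R (X i : MvPolynomial σ R)).restrict (fun p hp => by
      rw [add_comm]
      exact (isHomogeneous_X R i).mul hp)
  rw [gradedLength, length_quotient_eq_add f]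
  congr 1
  rw [gradedLength]
  have : (J.restrictScalars R).comap (homogeneousSubmodule σ R (n + 1)).subtype ⊔
      LinearMap.range f = ((J ⊔ Ideal.span {X i}).restrictScalars R).comap
        (homogeneousSubmodule σ R (n + 1)).subtype := by
    apply le_antisymm
    · refine sup_le (Submodule.comap_mono (le_sup_left (a := J))) ?_
      rintro _ ⟨p, rfl⟩
      exact Ideal.mem_sup_right (Ideal.mem_span_singleton.2 ⟨p.1, rfl⟩)
    · rintro ⟨p, hp⟩ hpJ
      obtain ⟨j, hj, w, hw, hjw⟩ := Submodule.mem_sup.1 (show p ∈ J ⊔ Ideal.span {X i} from hpJ)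
      obtain ⟨q, rfl⟩ := Ideal.mem_span_singleton.1 hw
      refine Submodule.mem_sup.2 ⟨⟨homogeneousComponent (n + 1) j,
        homogeneousComponent_mem _ _⟩, hJ _ hj _, _,
        ⟨⟨homogeneousComponent n q, homogeneousComponent_mem _ _⟩, rfl⟩, ?_⟩
      ext1
      change homogeneousComponent (n + 1) j + X i * homogeneousComponent n q = p
      rw [← homogeneousComponent_succ_X_mul, ← map_add, hjw, homogeneousComponent_eq_self hp]
  rw [this]

theorem gradedLength_zero_sup_span_X {J : Ideal (MvPolynomial σ R)} (hJ : IsGradedIdeal J)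
    (i : σ) : gradedLength (J ⊔ Ideal.span {X i}) 0 = gradedLength J 0 := by
  have : ((J ⊔ Ideal.span {X i}).restrictScalars R).comap (homogeneousSubmodule σ R 0).subtype =
      (J.restrictScalars R).comap (homogeneousSubmodule σ R 0).subtype := by
    refine le_antisymm ?_ (Submodule.comap_mono (le_sup_left (a := J)))
    rintro ⟨p, hp⟩ hpJ
    obtain ⟨j, hj, w, hw, hjw⟩ := Submodule.mem_sup.1 (show p ∈ J ⊔ Ideal.span {X i} from hpJ)
    obtain ⟨q, rfl⟩ := Ideal.mem_span_singleton.1 hw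
    change p ∈ J
    rw [← homogeneousComponent_eq_self hp, ← hjw, map_add, homogeneousComponent_zero_X_mul,
      add_zero]
    exact hJ _ hj _
  rw [gradedLength, this, gradedLength]

theorem gradedLength_succ_eq_zero {J : Ideal (MvPolynomial σ R)} (h : ∀ i, X i ∈ J) (n : ℕ) :
    gradedLength J (n + 1) = 0 := by
  rw [gradedLength, Module.length_eq_zero_iff, Submodule.Quotient.subsingleton_iff,
    eq_top_iff]
  rintro ⟨p, hp⟩ -
  have : p ∈ Ideal.span (X '' (Set.univ : Set σ)) := by
    rw [mem_ideal_span_X_image]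
    intro m hm
    by_contra! hc
    have hm0 : m = 0 := by ext i; simpa using hc i
    have := hp (MvPolynomial.mem_support_iff.1 hm)
    simp [hm0] at this
  refine (Ideal.span_le.2 ?_ : Ideal.span (X '' (Set.univ : Set σ)) ≤ J) this
  rintro _ ⟨i, -, rfl⟩
  exact h i

/-- The generating function of `f` is a rational function with denominator a power of `1 - X`. -/
def HasRationalSeries (f : ℕ → ℕ) : Prop :=
  ∃ (k : ℕ) (p : ℤ[X]),
    (1 - PowerSeries.X) ^ k * PowerSeries.mk (fun n => (f n : ℤ)) = (p : PowerSeries ℤ)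

theorem HasRationalSeries.of_succ_eq_add {f g h : ℕ → ℕ} (hg : HasRationalSeries g)
    (hh : HasRationalSeries h) (h0 : f 0 = h 0) (hs : ∀ n, f (n + 1) = g n + h (n + 1)) :
    HasRationalSeries f := by
  obtain ⟨k, p, hp⟩ := hg
  obtain ⟨l, q, hq⟩ := hh
  refine ⟨k + l, Polynomial.X * (1 - Polynomial.X) ^ l * p + (1 - Polynomial.X) ^ k * q, ?_⟩
  have : PowerSeries.mk (fun n => (f n : ℤ)) = PowerSeries.X * PowerSeries.mk (fun n => (g n : ℤ)) +
      PowerSeries.mk (fun n => (h n : ℤ)) := by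
    ext n
    cases n with
    | zero => simp [h0]
    | succ n => simp [PowerSeries.coeff_succ_X_mul, hs]
  rw [this]
  push_cast
  rw [← hp, ← hq]
  ring

/-- The recursion says `(1 - X) F = H` for the generating functions, so one more factor in the
denominator suffices. -/
theorem HasRationalSeries.of_succ_eq_self_add {f h : ℕ → ℕ}
    (hh : HasRationalSeries h) (h0 : f 0 = h 0) (hs : ∀ n, f (n + 1) = f n + h (n + 1)) :
    HasRationalSeries f := by
  obtain ⟨l, q, hq⟩ := hh
  refine ⟨l + 1, q, ?_⟩
  have : PowerSeries.mk (fun n => (f n : ℤ)) = PowerSeries.X * PowerSeries.mk (fun n => (f n : ℤ)) +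
      PowerSeries.mk (fun n => (h n : ℤ)) := by
    ext n
    cases n with
    | zero => simp [h0]
    | succ n => simp [PowerSeries.coeff_succ_X_mul, hs]
  rw [← hq, pow_succ, mul_assoc, sub_mul, one_mul]
  congr 1
  rw [sub_eq_iff_eq_add']
  exact this

/-- Noetherian induction on `J`: if some variable `X_i` is not in `J`, then `J + (X_i)` is strictly
larger, and `J : X_i` is either larger or equal to `J`. -/
theorem hasRationalSeries_gradedLength [IsNoetherianRing R] [Finite σ]
    (J : Ideal (MvPolynomial σ R)) (hJ : IsGradedIdeal J) (hfin : ∀ n, gradedLength J n ≠ ⊤) :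
    HasRationalSeries (fun n => (gradedLength J n).toNat) := by
  induction J using IsNoetherian.induction with
  | hgt J ih =>
  by_cases hX : ∀ i, X i ∈ J
  · refine ⟨0, Polynomial.C ((gradedLength J 0).toNat : ℤ), ?_⟩
    ext n
    cases n with
    | zero => simp
    | succ n => simp [gradedLength_succ_eq_zero hX]
  · push Not at hX
    obtain ⟨i, hi⟩ := hX
    have hfs : ∀ n, gradedLength (J ⊔ Ideal.span {X i}) n ≠ ⊤ := fun n =>
      ne_top_of_le_ne_top (hfin n) (gradedLength_anti le_sup_left n)
    have hfc : ∀ n, gradedLength (colonX J i) n ≠ ⊤ := fun n =>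
      ne_top_of_le_ne_top (hfin n) (gradedLength_anti (le_colonX J i) n)
    have hsup := ih (J ⊔ Ideal.span {X i}) (lt_of_le_of_ne le_sup_left fun h =>
      hi (h ▸ Ideal.mem_sup_right (Ideal.mem_span_singleton_self _))) (hJ.sup_span_X i) hfs
    have h0 : (gradedLength J 0).toNat = (gradedLength (J ⊔ Ideal.span {X i}) 0).toNat := by
      rw [gradedLength_zero_sup_span_X hJ]
    have hs : ∀ n, (gradedLength J (n + 1)).toNat = (gradedLength (colonX J i) n).toNat +
        (gradedLength (J ⊔ Ideal.span {X i}) (n + 1)).toNat := fun n => by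
      rw [gradedLength_succ hJ i, ENat.toNat_add (hfc n) (hfs _)]
    -- If `J : X_i = J`, the induction hypothesis says nothing about the colon ideal, but the
    -- recursion then involves only `J` itself and `J + (X_i)`.
    rcases (le_colonX J i).eq_or_lt with hc | hc
    · rw [← hc] at hs
      exact hsup.of_succ_eq_self_add h0 hs
    · exact (ih _ hc (hJ.colonX i) hfc).of_succ_eq_add hsup h0 hs

end HilbertSerre

/-! ### Presentation of the fiber cone -/

section FiberConeSeries

variable {R : Type*} [CommRing R] {r : ℕ}

/-- The homomorphism `R[X_1, …, X_r] → R[t]` sending `X_i` to `g_i t`; its image is the Rees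
algebra of the ideal generated by the `g_i`. -/
noncomputable def reesMap (g : Fin r → R) : MvPolynomial (Fin r) R →ₐ[R] R[X] :=
  MvPolynomial.aeval (fun i => Polynomial.C (g i) * Polynomial.X)

theorem reesMap_coeff_eq_ite (g : Fin r → R) {p : MvPolynomial (Fin r) R} {m : ℕ}
    (hp : p.IsHomogeneous m) (n : ℕ) :
    (reesMap g p).coeff n = if n = m then MvPolynomial.eval g p else 0 := by
  rw [reesMap, MvPolynomial.aeval_def, MvPolynomial.eval₂_eq, Polynomial.finsetSum_coeff,
    MvPolynomial.eval_eq]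
  have : ∀ e ∈ p.support, ((algebraMap R R[X]) (MvPolynomial.coeff e p) *
      ∏ i ∈ e.support, (Polynomial.C (g i) * Polynomial.X) ^ e i).coeff n =
      if n = m then MvPolynomial.coeff e p * ∏ i ∈ e.support, g i ^ e i else 0 := by
    intro e he
    have hdeg : ∑ i ∈ e.support, e i = m := hp.degree_eq_sum_deg_support he |>.symm
    simp only [mul_pow, Finset.prod_mul_distrib, Finset.prod_pow_eq_pow_sum, hdeg,
      Polynomial.algebraMap_eq, ← map_pow, ← map_prod]
    rw [← mul_assoc, ← map_mul, Polynomial.coeff_C_mul_X_pow]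
  rw [Finset.sum_congr rfl this]
  split_ifs <;> simp

theorem reesMap_coeff (g : Fin r → R) (p : MvPolynomial (Fin r) R) (n : ℕ) :
    (reesMap g p).coeff n = MvPolynomial.eval g (MvPolynomial.homogeneousComponent n p) := by
  conv_lhs => rw [← MvPolynomial.sum_homogeneousComponent p]
  rw [map_sum, Polynomial.finsetSum_coeff]
  simp only [reesMap_coeff_eq_ite g (MvPolynomial.homogeneousComponent_isHomogeneous _ p)]
  rw [Finset.sum_ite_eq]
  split_ifs with h
  · rfl
  · rw [MvPolynomial.homogeneousComponent_eq_zero, map_zero]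
    simpa using h

theorem reesMap_coeff_mem (g : Fin r → R) (p : MvPolynomial (Fin r) R) (n : ℕ) :
    (reesMap g p).coeff n ∈ Ideal.span (Set.range g) ^ n := by
  rw [reesMap_coeff, Ideal.mem_span_pow_iff_exists_isHomogeneous]
  exact ⟨_, MvPolynomial.homogeneousComponent_isHomogeneous _ _, rfl⟩

/-- The ideal of relations of the fiber cone of `(g_1, …, g_r)` with respect to `I`. -/
noncomputable def relationIdeal (I : Ideal R) (g : Fin r → R) : Ideal (MvPolynomial (Fin r) R) where
  carrier := {p | ∀ n, (reesMap g p).coeff n ∈ I * Ideal.span (Set.range g) ^ n}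
  add_mem' hp hq n := by
    rw [map_add, Polynomial.coeff_add]
    exact add_mem (hp n) (hq n)
  zero_mem' n := by simp
  smul_mem' p q hq n := by
    rw [smul_eq_mul, map_mul, Polynomial.coeff_mul]
    refine sum_mem fun x hx => ?_
    rw [← Finset.HasAntidiagonal.mem_antidiagonal.1 hx, pow_add, mul_left_comm]
    exact Ideal.mul_mem_mul (reesMap_coeff_mem g p _) (hq _)

theorem mem_relationIdeal {I : Ideal R} {g : Fin r → R} {p : MvPolynomial (Fin r) R} :
    p ∈ relationIdeal I g ↔ ∀ n, (reesMap g p).coeff n ∈ I * Ideal.span (Set.range g) ^ n :=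
  Iff.rfl

theorem mem_relationIdeal_of_isHomogeneous {I : Ideal R} {g : Fin r → R}
    {p : MvPolynomial (Fin r) R} {n : ℕ} (hp : p.IsHomogeneous n) :
    p ∈ relationIdeal I g ↔ MvPolynomial.eval g p ∈ I * Ideal.span (Set.range g) ^ n := by
  rw [mem_relationIdeal]
  simp only [reesMap_coeff_eq_ite g hp]
  constructor
  · intro h
    simpa using h n
  · intro h m
    split_ifs with hm
    · exact hm ▸ h
    · exact zero_mem _

theorem isGradedIdeal_relationIdeal (I : Ideal R) (g : Fin r → R) :
    IsGradedIdeal (relationIdeal I g) := by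
  intro p hp n
  rw [mem_relationIdeal_of_isHomogeneous (MvPolynomial.homogeneousComponent_isHomogeneous n p),
    ← reesMap_coeff]
  exact hp n

/-- Evaluation at `g` maps the forms of degree `n` onto the `n`-th power of `(g_1, …, g_r)`, and the
forms landing in `I` times that power are exactly those in the relation ideal. -/
theorem gradedLength_relationIdeal (I : Ideal R) (g : Fin r → R) (n : ℕ) :
    gradedLength (relationIdeal I g) n =
      Module.length R (component I (Ideal.span (Set.range g)) n) := by
  let f : MvPolynomial.homogeneousSubmodule (Fin r) R n →ₗ[R] ↥(Ideal.span (Set.range g) ^ n) :=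
    (MvPolynomial.aeval g : MvPolynomial (Fin r) R →ₐ[R] R).toLinearMap.restrict (fun p hp =>
      (Ideal.mem_span_pow_iff_exists_isHomogeneous g _).2 ⟨p, hp, rfl⟩)
  have hf : Function.Surjective f := by
    rintro ⟨y, hy⟩
    obtain ⟨p, hp, rfl⟩ := (Ideal.mem_span_pow_iff_exists_isHomogeneous g y).1 hy
    exact ⟨⟨p, hp⟩, rfl⟩
  rw [length_quotient_eq_of_surjective f hf, gradedLength]
  have : Submodule.comap (MvPolynomial.homogeneousSubmodule (Fin r) R n).subtype
      ((relationIdeal I g).restrictScalars R) =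
      Submodule.comap f ((I * Ideal.span (Set.range g) ^ n).submoduleOf _) := by
    ext ⟨p, hp⟩
    exact mem_relationIdeal_of_isHomogeneous hp
  rw [this]

theorem hasRationalSeries_length_component [IsNoetherianRing R] (I₁ I₂ : Ideal R)
    (hfin : ∀ n, Module.length R (component I₁ I₂ n) ≠ ⊤) :
    HasRationalSeries (fun n => (Module.length R (component I₁ I₂ n)).toNat) := by
  obtain ⟨r, g, rfl⟩ := Submodule.fg_iff_exists_fin_generating_family.1
    (IsNoetherian.noetherian I₂)
  simp only [← gradedLength_relationIdeal] at hfin ⊢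
  exact hasRationalSeries_gradedLength _ (isGradedIdeal_relationIdeal _ _) hfin

end FiberConeSeries

end FiberCone

namespace FiberCone

/-! ### Growth of the lengths in terms of the dimension -/

section Bounds

variable {R : Type*} [CommRing R]

theorem length_quotient_eq_submoduleOf_add {B : Type*} [AddCommGroup B] [Module R B]
    {N M : Submodule R B} (h : N ≤ M) :
    Module.length R (B ⧸ N) =
      Module.length R (M ⧸ N.submoduleOf M) + Module.length R (B ⧸ M) := by
  rw [length_quotient_eq_add M.subtype N, Submodule.range_subtype, sup_eq_right.2 h]
  rfl

/-- Since `I₂^(n+s) ⊆ I₁ I₂^n`, the component is a quotient of `I₂^n / I₂^(n+s)`. -/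
theorem length_component_add_le {I₁ I₂ : Ideal R} {s : ℕ} (hs : I₂ ^ s ≤ I₁) (n : ℕ) :
    Module.length R (component I₁ I₂ n) + Module.length R (R ⧸ I₂ ^ n) ≤
      Module.length R (R ⧸ I₂ ^ (n + s)) := by
  have h : I₂ ^ (n + s) ≤ I₂ ^ n := Ideal.pow_le_pow_right (Nat.le_add_right n s)
  rw [length_quotient_eq_submoduleOf_add h]
  gcongr
  refine length_quotient_anti (Submodule.comap_mono ?_)
  rw [add_comm, pow_add]
  exact Ideal.mul_mono_left hs

variable [IsLocalRing R] [IsNoetherianRing R]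

theorem exists_length_quotient_pow_le {d : ℕ} (hd : ringKrullDim R = d) {I : Ideal R}
    (hI : I.radical = IsLocalRing.maximalIdeal R) :
    ∃ C : ℕ, ∀ n : ℕ, Module.length R (R ⧸ I ^ n) ≤ ((C * n ^ d : ℕ) : ℕ∞) := by
  -- The elements of `s` form a system of parameters: there are `d` of them and the maximal ideal is
  -- minimal over them.
  obtain ⟨s, hs, hcard⟩ :=
    (IsLocalRing.maximalIdeal R).exists_finset_card_eq_height_of_isNoetherianRing
  have hsd : s.card = d := by
    have h := IsLocalRing.maximalIdeal_height_eq_ringKrullDim (R := R)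
    rw [hd, ← hcard] at h
    exact_mod_cast h
  have := IsLocalRing.quotient_artinian_of_mem_minimalPrimes_of_isLocalRing _ hs
  have : IsArtinian R (R ⧸ Ideal.span (s : Set R)) :=
    isArtinian_of_surjective_algebraMap (S := R) (R := R ⧸ Ideal.span (s : Set R)) (M := R ⧸ Ideal.span (s : Set R))
      Ideal.Quotient.mk_surjective
  have hL : Module.length R (R ⧸ Ideal.span (s : Set R)) ≠ ⊤ := Module.length_ne_top
  obtain ⟨t, ht⟩ := Ideal.exists_pow_le_of_le_radical_of_fg (hs.1.2.trans hI.ge)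
    (IsNoetherian.noetherian (Ideal.span (s : Set R)))
  refine ⟨t ^ d * (Module.length R (R ⧸ Ideal.span (s : Set R))).toNat, fun n => ?_⟩
  have h1 : Ideal.span (s : Set R) ^ (t * n) ≤ I ^ n := by
    rw [pow_mul]
    exact Ideal.pow_right_mono ht n
  refine (length_quotient_anti h1).trans ((length_quotient_span_pow_le s (t * n)).trans ?_)
  rw [hsd]
  push_cast
  rw [ENat.natCast_toNat hL, mul_pow, mul_right_comm]

theorem length_quotient_pow_ne_top {I : Ideal R}
    (hI : I.radical = IsLocalRing.maximalIdeal R) (n : ℕ) :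
    Module.length R (R ⧸ I ^ n) ≠ ⊤ := by
  have hd : ringKrullDim R = ((IsLocalRing.maximalIdeal R).height.toNat : ℕ) := by
    rw [← IsLocalRing.maximalIdeal_height_eq_ringKrullDim]
    conv_lhs => rw [← ENat.natCast_toNat (Ideal.height_ne_top
      (I := IsLocalRing.maximalIdeal R) Ideal.IsPrime.ne_top')]
    rfl
  obtain ⟨C, hC⟩ := exists_length_quotient_pow_le hd hI
  exact ne_top_of_le_ne_top (ENat.natCast_ne_top _) (hC n)

theorem length_component_ne_top {I₁ I₂ : Ideal R}
    (hI₁ : I₁.radical = IsLocalRing.maximalIdeal R)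
    (hI₂ : I₂.radical = IsLocalRing.maximalIdeal R) (n : ℕ) :
    Module.length R (component I₁ I₂ n) ≠ ⊤ := by
  obtain ⟨s, hs⟩ := Ideal.exists_pow_le_of_le_radical_of_fg
    (Ideal.le_radical.trans (hI₂.trans hI₁.symm).le) (IsNoetherian.noetherian I₂)
  exact ne_top_of_le_ne_top (length_quotient_pow_ne_top hI₂ (n + s))
    (le_self_add.trans (length_component_add_le hs n))

theorem exists_sum_length_component_le {d : ℕ} (hd : ringKrullDim R = d) {I₁ I₂ : Ideal R}
    (hI₁ : I₁.radical = IsLocalRing.maximalIdeal R)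
    (hI₂ : I₂.radical = IsLocalRing.maximalIdeal R) :
    ∃ C s : ℕ, 0 < s ∧ ∀ N : ℕ, ∑ m ∈ Finset.range N,
      (Module.length R (component I₁ I₂ (s * m))).toNat ≤ C * N ^ d := by
  obtain ⟨s, hs⟩ := Ideal.exists_pow_le_of_le_radical_of_fg
    (Ideal.le_radical.trans (hI₂.trans hI₁.symm).le) (IsNoetherian.noetherian I₂)
  -- The exponent is raised by one to make the step positive.
  have hs' : I₂ ^ (s + 1) ≤ I₁ := (Ideal.pow_le_pow_right (Nat.le_succ s)).trans hs
  obtain ⟨C, hC⟩ := exists_length_quotient_pow_le hd hI₂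
  refine ⟨C * (s + 1) ^ d, s + 1, s.succ_pos, fun N => ?_⟩
  -- Telescoping of `length_component_add_le` along multiples of the step.
  have key : ∑ m ∈ Finset.range N, Module.length R (component I₁ I₂ ((s + 1) * m)) ≤
      Module.length R (R ⧸ I₂ ^ ((s + 1) * N)) := by
    induction N with
    | zero => simp
    | succ N ih =>
      rw [Finset.sum_range_succ, add_comm]
      exact (add_le_add le_rfl ih).trans (length_component_add_le hs' _)
  have h2 := key.trans (hC _)
  have h3 : ∀ m ∈ Finset.range N, Module.length R (component I₁ I₂ ((s + 1) * m)) =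
      ((Module.length R (component I₁ I₂ ((s + 1) * m))).toNat : ℕ∞) := fun m _ =>
    (ENat.natCast_toNat (length_component_ne_top hI₁ hI₂ _)).symm
  rw [Finset.sum_congr rfl h3, ← Nat.cast_sum, Nat.cast_le, mul_pow, ← mul_assoc] at h2
  exact h2

end Bounds

/-! ### Bounding the pole order of the Hilbert series -/

section Numeric

theorem coe_map_int_cast (p : ℤ[X]) :
    ((p.map (Int.castRingHom ℚ) : ℚ[X]) : PowerSeries ℚ) =
      PowerSeries.map (Int.castRingHom ℚ) (p : PowerSeries ℤ) :=
  Polynomial.polynomial_map_coe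

theorem mk_eq_mul_invOneSubPow {f : ℕ → ℕ} {k : ℕ} {p : ℤ[X]}
    (hp : (1 - PowerSeries.X) ^ k * PowerSeries.mk (fun n => (f n : ℤ)) = (p : PowerSeries ℤ)) :
    PowerSeries.mk (fun n => (f n : ℚ)) =
      ((p.map (Int.castRingHom ℚ) : ℚ[X]) : PowerSeries ℚ) * PowerSeries.invOneSubPow ℚ k := by
  have h1 : PowerSeries.map (Int.castRingHom ℚ) (PowerSeries.mk (fun n => (f n : ℤ))) =
      PowerSeries.mk (fun n => (f n : ℚ)) := by
    ext n
    simp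
  have h2 := (PowerSeries.invOneSubPow ℚ k).inv_val
  rw [PowerSeries.invOneSubPow_inv_eq_one_sub_pow] at h2
  rw [coe_map_int_cast, ← hp, map_mul, h1, map_pow, map_sub, map_one, PowerSeries.map_X,
    mul_right_comm, h2, one_mul]

/-- If the pole order `k` exceeded `d`, then `f` would agree eventually with a polynomial of degree
`k - 1 ≥ d`, and the terms with `N ≤ m < 2N` alone would sum to at least a constant times `N^(d+1)`.
-/
theorem exists_mul_eq_of_sum_le {f : ℕ → ℕ} (hf : HasRationalSeries f) {d C s : ℕ} (hs : 0 < s)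
    (hsum : ∀ N, ∑ m ∈ Finset.range N, f (s * m) ≤ C * N ^ d) :
    ∃ h : ℤ[X], (1 - PowerSeries.X) ^ d * PowerSeries.mk (fun n => (f n : ℤ)) =
      (h : PowerSeries ℤ) := by
  classical
  obtain ⟨p, hp⟩ := Nat.find_spec hf
  set k := Nat.find hf with hk
  by_cases hkd : k ≤ d
  · refine ⟨(1 - Polynomial.X) ^ (d - k) * p, ?_⟩
    push_cast
    rw [← hp, ← mul_assoc, ← pow_add, Nat.sub_add_cancel hkd]
  exfalso
  push Not at hkd
  obtain ⟨e, he⟩ : ∃ e, k = e + 1 := ⟨k - 1, by omega⟩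
  -- Otherwise a factor `1 - X` cancels, against the minimality of `k`.
  have hp1 : p.eval 1 ≠ 0 := by
    intro h0
    obtain ⟨q, hq⟩ := Polynomial.dvd_iff_isRoot.2 h0
    refine Nat.find_min hf (m := e) (by omega) ⟨-q, ?_⟩
    have hX : (1 - PowerSeries.X : PowerSeries ℤ) ≠ 0 := by
      intro h
      have := congrArg (PowerSeries.coeff 0) h
      simp at this
    apply mul_left_cancel₀ hX
    rw [← mul_assoc, ← pow_succ', ← he, hp, hq]
    push_cast
    simp only [map_one]
    ring
  set pq : ℚ[X] := p.map (Int.castRingHom ℚ) with hpq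
  -- The coefficient of degree `e` is `p(1) / e!`.
  have hcoeff : (Polynomial.hilbertPoly pq k).coeff e ≠ 0 := by
    have h1 : pq.eval 1 ≠ 0 := by
      rw [hpq, Polynomial.eval_one_map]
      simpa using hp1
    rw [he, Polynomial.hilbertPoly_succ, Polynomial.finsetSum_coeff]
    simp only [Polynomial.coeff_smul, Polynomial.coeff_preHilbertPoly_self, smul_eq_mul]
    rw [← Finset.sum_mul]
    refine mul_ne_zero ?_ (inv_ne_zero (by positivity))
    rw [Polynomial.eval_eq_sum, Polynomial.sum_def] at h1
    simpa using h1
  have heval : ∀ n, pq.natDegree < n → (Polynomial.hilbertPoly pq k).eval (n : ℚ) = f n := by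
    intro n hn
    rw [← Polynomial.coeff_mul_invOneSubPow_eq_hilbertPoly_eval k hn, ← mk_eq_mul_invOneSubPow hp,
      PowerSeries.coeff_mk]
  have hO := Polynomial.isBigO_atTop_of_degree_le (X ^ d : ℚ[X]) (Polynomial.hilbertPoly pq k) (by
    rw [Polynomial.degree_X_pow]
    refine le_trans ?_ (Polynomial.le_degree_of_ne_zero hcoeff)
    exact_mod_cast (by omega : d ≤ e))
  obtain ⟨c, hc0, hc⟩ := hO.exists_pos
  rw [Asymptotics.isBigOWith_iff] at hc
  obtain ⟨n₀, hn₀⟩ := eventually_atTop.1 (tendsto_natCast_atTop_atTop (R := ℚ) |>.eventually hc)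
  obtain ⟨B, hB⟩ := exists_nat_gt (c * C * 2 ^ d)
  -- Beyond `n₀` the growth estimate holds, beyond the degree `f` equals its polynomial, and `N ≥ B`
  -- contradicts the final bound `N ≤ c C 2^d`.
  set N := n₀ + pq.natDegree + B + 1 with hN
  have hle : ∀ m ∈ Finset.Ico N (2 * N), (N : ℝ) ^ d ≤ c * f (s * m) := by
    intro m hm
    rw [Finset.mem_Ico] at hm
    have hsm : m ≤ s * m := Nat.le_mul_of_pos_left m hs
    have h1 := hn₀ (s * m) (by omega)
    rw [heval _ (by omega)] at h1
    have hnorm : ∀ a : ℕ, ‖(a : ℚ)‖ = a := fun a => by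
      rw [← Rat.norm_cast_real, Rat.cast_natCast, Real.norm_natCast]
    simp only [Polynomial.eval_pow, Polynomial.eval_X, norm_pow, hnorm] at h1
    refine le_trans ?_ h1
    gcongr
    omega
  have hS : (N : ℝ) * N ^ d ≤ c * ∑ m ∈ Finset.range (2 * N), (f (s * m) : ℝ) := by
    calc (N : ℝ) * N ^ d = ∑ m ∈ Finset.Ico N (2 * N), (N : ℝ) ^ d := by
          rw [Finset.sum_const, Nat.card_Ico, nsmul_eq_mul]; congr 2; omega
      _ ≤ ∑ m ∈ Finset.Ico N (2 * N), c * (f (s * m) : ℝ) := Finset.sum_le_sum hle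
      _ = c * ∑ m ∈ Finset.Ico N (2 * N), (f (s * m) : ℝ) := by rw [Finset.mul_sum]
      _ ≤ _ := by
        gcongr
        intro m hm
        simp at hm ⊢
        omega
  have hS2 : (∑ m ∈ Finset.range (2 * N), (f (s * m) : ℝ)) ≤ C * (2 * N) ^ d := by
    exact_mod_cast hsum (2 * N)
  have hNpos : (0 : ℝ) < (N : ℝ) ^ d := by positivity
  have : (N : ℝ) * N ^ d ≤ (c * C * 2 ^ d) * N ^ d := by
    calc _ ≤ _ := hS
      _ ≤ c * (C * (2 * N) ^ d) := by gcongr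
      _ = _ := by rw [mul_pow]; ring
  have h4 := le_of_mul_le_mul_right this hNpos
  have h5 : (B : ℝ) ≤ N := by rw [hN]; push_cast; linarith [n₀.cast_nonneg (α := ℝ), pq.natDegree.cast_nonneg (α := ℝ)]
  linarith

end Numeric

end FiberCone

namespace FiberCone

/-! ### Differences of binomial tails and binomial identities -/

section Numeric

/-- The tail `n < k` of the function `n ↦ (n - k + r choose r)`. -/
noncomputable def binomialTail (r k : ℕ) (n : ℤ) : ℚ :=
  if n < k then (preHilbertPoly ℚ r 0).eval ((n : ℚ) - k) else 0

theorem preHilbertPoly_eval_sub (r k : ℕ) (x : ℚ) :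
    (preHilbertPoly ℚ r k).eval x = (preHilbertPoly ℚ r 0).eval (x - k) := by
  simp [preHilbertPoly]

theorem preHilbertPoly_succ_eval_sub (r : ℕ) (x : ℚ) :
    (preHilbertPoly ℚ (r + 1) 0).eval x - (preHilbertPoly ℚ (r + 1) 0).eval (x - 1) =
      (preHilbertPoly ℚ r 0).eval x := by
  have h1 : (ascPochhammer ℚ (r + 1)).eval (x + 1) =
      (ascPochhammer ℚ r).eval (x + 1) * (x + 1 + r) := ascPochhammer_succ_eval r (x + 1)
  have h2 : (ascPochhammer ℚ (r + 1)).eval x = x * (ascPochhammer ℚ r).eval (x + 1) := by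
    rw [ascPochhammer_succ_left]
    simp
  have h3 : ((r + 1).factorial : ℚ) = (r + 1) * r.factorial := by
    rw [Nat.factorial_succ]; push_cast; ring
  have h4 : (r.factorial : ℚ) ≠ 0 := by positivity
  have h5 : (r + 1 : ℚ) ≠ 0 := by positivity
  simp only [preHilbertPoly, eval_smul, eval_comp, eval_add, eval_sub, eval_X, eval_C, eval_one,
    Nat.cast_zero, sub_zero, sub_add_cancel, smul_eq_mul, h1, h2, h3]
  field_simp
  ring

theorem preHilbertPoly_succ_eval_neg_one (r : ℕ) :
    (preHilbertPoly ℚ (r + 1) 0).eval (-1) = 0 := by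
  simp [preHilbertPoly]

/-- Pascal's rule away from the cutoff. At `n = k` both sides vanish because `(x + r + 1 choose r +
1)` is zero at `x = -1`. -/
theorem Δ_binomialTail_succ (r k : ℕ) : Δ (binomialTail (r + 1) k) = binomialTail r k := by
  ext n
  simp only [Δ, binomialTail]
  rcases lt_trichotomy n k with h | h | h
  · have h' : n - 1 < k := by omega
    rw [if_pos h, if_pos h', if_pos h, ← preHilbertPoly_succ_eval_sub r]
    congr 2
    push_cast
    ring
  · have h' : n - 1 < k := by omega
    have h'' : ¬ n < k := by omega
    rw [if_neg h'', if_pos h', if_neg h'', h]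
    push_cast
    rw [show (k - 1 - k : ℚ) = -1 by ring, preHilbertPoly_succ_eval_neg_one, sub_zero]
  · have h' : ¬ n - 1 < k := by omega
    have h'' : ¬ n < k := by omega
    rw [if_neg h'', if_neg h', if_neg h'', sub_zero]

theorem Δ_iterate_binomialTail (r k : ℕ) (n : ℤ) :
    Δ^[r] (binomialTail r k) n = if n < k then 1 else 0 := by
  induction r with
  | zero => simp [binomialTail, preHilbertPoly]
  | succ r ih => rw [Function.iterate_succ_apply, Δ_binomialTail_succ, ih]

theorem Δ_iterate_sum {ι : Type*} (s : Finset ι) (c : ι → ℚ) (u : ι → ℤ → ℚ) (r : ℕ) :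
    Δ^[r] (fun n => ∑ k ∈ s, c k * u k n) = fun n => ∑ k ∈ s, c k * Δ^[r] (u k) n := by
  induction r generalizing u with
  | zero => rfl
  | succ r ih =>
    have : Δ (fun n => ∑ k ∈ s, c k * u k n) = fun n => ∑ k ∈ s, c k * Δ (u k) n := by
      ext n
      simp only [Δ, mul_sub, Finset.sum_sub_distrib]
    simp only [Function.iterate_succ_apply]
    rw [this, ih]

theorem hasSum_mul_sum_ite_lt (a : ℕ) (φ c : ℕ → ℚ) (s : Finset ℕ) :
    HasSum (fun n : {n : ℕ // a ≤ n} =>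
      φ n * ∑ k ∈ s, c k * if (((n : ℕ) : ℤ) < k) then 1 else 0)
      (∑ k ∈ s, c k * ∑ n ∈ Finset.Ico a k, φ n) := by
  simp only [Finset.mul_sum s]
  refine hasSum_sum fun k _ => ?_
  have h : HasSum (fun n : {n : ℕ // a ≤ n} => if (n : ℕ) < k then φ n else 0)
      (∑ n ∈ Finset.Ico a k, φ n) := by
    refine (hasSum_subtype_iff_indicator (s := {n | a ≤ n})
      (f := fun n : ℕ => if n < k then φ n else 0)).2 ?_
    have h1 : ∑ n ∈ Finset.Ico a k, φ n = ∑ n ∈ Finset.Ico a k,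
        Set.indicator {n | a ≤ n} (fun n : ℕ => if n < k then φ n else 0) n := by
      refine Finset.sum_congr rfl fun n hn => ?_
      rw [Finset.mem_Ico] at hn
      simp [Set.indicator, hn.1, hn.2]
    rw [h1]
    refine hasSum_sum_of_ne_finset_zero fun n hn => ?_
    rw [Finset.mem_Ico, not_and] at hn
    by_cases ha : a ≤ n
    · simp [Set.indicator, ha, hn ha]
    · simp [Set.indicator, ha]
  have hfun : (fun n : {n : ℕ // a ≤ n} => φ n * (c k * if (((n : ℕ) : ℤ) < k) then 1 else 0)) =
      fun n : {n : ℕ // a ≤ n} => c k * if (n : ℕ) < k then φ n else 0 := by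
    funext n
    simp only [Nat.cast_lt]
    split_ifs <;> ring
  rw [hfun]
  exact h.mul_left (c k)

theorem sum_Ico_choose (j k : ℕ) : ∑ n ∈ Finset.Ico j k, n.choose j = k.choose (j + 1) := by
  induction k with
  | zero => simp
  | succ k ih =>
    rcases le_or_gt j k with h | h
    · rw [Finset.sum_Ico_succ_top h, ih, Nat.choose_succ_succ, add_comm]
    · rw [Finset.Ico_eq_empty (by omega), Nat.choose_eq_zero_of_lt (by omega), Finset.sum_empty]

theorem sum_range_alternating_choose_succ (i k : ℕ) :
    ∑ j ∈ Finset.range (i + 1), (-1 : ℚ) ^ j * ((k + 1).choose j : ℚ) = (-1) ^ i * k.choose i := by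
  induction i with
  | zero => simp
  | succ i ih =>
    rw [Finset.sum_range_succ, ih, Nat.choose_succ_succ]
    push_cast
    ring

/-- For `k ≥ 1` both sides are `(k - 1 choose i)`. For `k = 0` the left side is empty while the
alternating sum is `1`, hence the correction term. -/
theorem sum_Ico_choose_pred {i : ℕ} (hi : 1 ≤ i) (k : ℕ) :
    ∑ n ∈ Finset.Ico i k, ((n - 1).choose (i - 1) : ℚ) =
      (-1) ^ i * ∑ j ∈ Finset.range (i + 1), (-1 : ℚ) ^ j * (k.choose j : ℚ) +
        (-1) ^ (i + 1) * if k = 0 then 1 else 0 := by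
  obtain ⟨i, rfl⟩ := Nat.exists_eq_add_of_le' hi
  cases k with
  | zero =>
    rw [Finset.sum_range_succ']
    simp
    ring
  | succ k =>
    rw [sum_range_alternating_choose_succ, ← mul_assoc, ← mul_pow, ← Finset.sum_Ico_add']
    simp only [Nat.add_sub_cancel]
    rw [← Nat.cast_sum, sum_Ico_choose]
    simp

/-- Expand `X^k = (1 - (1 - X))^k`; each factor `1 - X` lowers the pole order by one. The induction
uses `X^(k+1) = X^k - X^k (1 - X)` and Pascal's rule. -/
theorem hilbertPoly_X_pow (d k : ℕ) :
    hilbertPoly (X ^ k : ℚ[X]) d = ∑ i ∈ Finset.range d,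
      ((-1) ^ i * (k.choose i : ℚ)) • preHilbertPoly ℚ (d - 1 - i) 0 := by
  induction k generalizing d with
  | zero =>
    cases d with
    | zero => rfl
    | succ d =>
      rw [Finset.sum_range_succ', hilbertPoly_X_pow_succ]
      simp
  | succ k ih =>
    cases d with
    | zero => rfl
    | succ d =>
      have h : (X ^ (k + 1) : ℚ[X]) = X ^ k + (-1 : ℚ) • (X ^ k * (1 - X)) := by
        rw [neg_one_smul]; ring
      rw [h, hilbertPoly_add_left, hilbertPoly_smul, hilbertPoly_mul_one_sub_succ, ih, ih,
        Finset.sum_range_succ', Finset.sum_range_succ', Finset.smul_sum, add_right_comm,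
        ← Finset.sum_add_distrib]
      congr 1
      · refine Finset.sum_congr rfl fun i _ => ?_
        rw [show d + 1 - 1 - (i + 1) = d - 1 - i by omega, smul_smul, ← add_smul,
          Nat.choose_succ_succ]
        congr 1
        push_cast
        ring
      · simp

/-- The polynomial sequence `(X + k choose k)`, indexed by `k`. -/
noncomputable def preHilbertSequence : Polynomial.Sequence ℚ where
  elems' k := preHilbertPoly ℚ k 0
  degree_eq' k := by
    have h := coeff_preHilbertPoly_self ℚ k 0
    have h0 : preHilbertPoly ℚ k 0 ≠ 0 := by
      intro h0
      rw [h0, coeff_zero] at h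
      exact inv_ne_zero (by positivity) h.symm
    rw [degree_eq_natDegree h0, natDegree_preHilbertPoly]

/-- The polynomials `(X + k choose k)` have distinct degrees, so they are linearly independent. -/
theorem IsCoefficientSequence.unique {d : ℕ} {P : ℚ[X]} {f g : Fin d → ℤ}
    (hf : IsCoefficientSequence d P f) (hg : IsCoefficientSequence d P g) : f = g := by
  have hli : LinearIndependent ℚ (fun i : Fin d => preHilbertPoly ℚ (d - 1 - i) 0) :=
    preHilbertSequence.linearIndependent.comp (fun i : Fin d => d - 1 - (i : ℕ)) (fun i j h => by
      have h' : d - 1 - (i : ℕ) = d - 1 - (j : ℕ) := h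
      ext
      omega)
  have h := Fintype.linearIndependent_iff.1 hli
    (fun i => (-1) ^ (i : ℕ) * (f i : ℚ) - (-1) ^ (i : ℕ) * (g i : ℚ)) (by
      simp only [sub_smul, Finset.sum_sub_distrib]
      rw [← hf, ← hg, sub_self])
  ext i
  have hi := h i
  rw [← mul_sub, mul_eq_zero, or_iff_right (pow_ne_zero _ (by norm_num)), sub_eq_zero] at hi
  exact_mod_cast hi

end Numeric

/-! ### Hilbert polynomial, coefficients and defect from the numerator -/

section Hilbert

variable {R : Type*} [CommRing R] {I₁ I₂ : Ideal R}

theorem IsHilbertPolynomial.unique {P Q : ℚ[X]} (hP : IsHilbertPolynomial I₁ I₂ P)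
    (hQ : IsHilbertPolynomial I₁ I₂ Q) : P = Q := by
  apply eq_of_infinite_eval_eq
  obtain ⟨N, hN⟩ := eventually_atTop.1 (hP.and hQ)
  refine ((Set.Ici_infinite N).image (Int.cast_injective (α := ℚ)).injOn).mono ?_
  rintro _ ⟨n, hn, rfl⟩
  exact (hN n hn).1.trans (hN n hn).2.symm

theorem IsHilbertPolynomial.hilbertPolynomial_eq {P : ℚ[X]} (hP : IsHilbertPolynomial I₁ I₂ P) :
    hilbertPolynomial I₁ I₂ = P := by
  have h : ∃ P : ℚ[X], IsHilbertPolynomial I₁ I₂ P := ⟨P, hP⟩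
  rw [hilbertPolynomial, dif_pos h]
  exact h.choose_spec.unique hP

theorem IsCoefficientSequence.hilbertCoefficient_eq {d : ℕ} {f : Fin d → ℤ}
    (hf : IsCoefficientSequence d (hilbertPolynomial I₁ I₂) f) :
    hilbertCoefficient d I₁ I₂ = f := by
  have h : ∃ f : Fin d → ℤ, IsCoefficientSequence d (hilbertPolynomial I₁ I₂) f := ⟨f, hf⟩
  rw [hilbertCoefficient, dif_pos h]
  exact h.choose_spec.unique hf

theorem hilbertFunction_natCast (n : ℕ) :
    hilbertFunction I₁ I₂ n = (Module.length R (component I₁ I₂ n)).toNat := by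
  simp [hilbertFunction]

theorem hilbertFunction_of_neg {n : ℤ} (hn : n < 0) : hilbertFunction I₁ I₂ n = 0 := by
  simp [hilbertFunction, hn]

theorem length_component_zero (I₁ I₂ : Ideal R) :
    Module.length R (component I₁ I₂ 0) = Module.length R (R ⧸ I₁) := by
  have hsurj : Function.Surjective (I₂ ^ 0).subtype := fun x => ⟨⟨x, by simp⟩, rfl⟩
  rw [length_quotient_eq_of_surjective _ hsurj]
  have : (I₁ * I₂ ^ 0).submoduleOf (I₂ ^ 0) = Submodule.comap (I₂ ^ 0).subtype I₁ := by
    rw [Submodule.submoduleOf]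
    congr 1
    simp
  exact (Submodule.quotEquivOfEq _ _ this).length_eq

variable {d : ℕ} {h : ℤ[X]}

/-- The Hilbert series of the fiber cone is `h / (1 - X) ^ d`. -/
def IsNumerator (I₁ I₂ : Ideal R) (d : ℕ) (h : ℤ[X]) : Prop :=
  (1 - PowerSeries.X) ^ d *
    PowerSeries.mk (fun n => ((Module.length R (component I₁ I₂ n)).toNat : ℤ)) =
      (h : PowerSeries ℤ)

theorem IsNumerator.hilbertFunction_eq (hh : IsNumerator I₁ I₂ d h) (n : ℕ) :
    (hilbertFunction I₁ I₂ n : ℚ) = PowerSeries.coeff n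
      (((h.map (Int.castRingHom ℚ) : ℚ[X]) : PowerSeries ℚ) * (PowerSeries.invOneSubPow ℚ d).val) := by
  rw [← mk_eq_mul_invOneSubPow hh, PowerSeries.coeff_mk, hilbertFunction_natCast]

theorem IsNumerator.isHilbertPolynomial (hh : IsNumerator I₁ I₂ d h) :
    IsHilbertPolynomial I₁ I₂ (hilbertPoly (h.map (Int.castRingHom ℚ)) d) := by
  filter_upwards [eventually_gt_atTop ((h.map (Int.castRingHom ℚ)).natDegree : ℤ)] with n hn
  lift n to ℕ using by omega
  rw [hh.hilbertFunction_eq, coeff_mul_invOneSubPow_eq_hilbertPoly_eval d (by exact_mod_cast hn)]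
  simp

theorem IsNumerator.coeff_zero_eq (hh : IsNumerator I₁ I₂ d h) :
    h.coeff 0 = (Module.length R (R ⧸ I₁)).toNat := by
  have := congrArg PowerSeries.constantCoeff hh
  simp only [map_mul, map_pow, map_sub, map_one, PowerSeries.constantCoeff_X, sub_zero, one_pow,
    one_mul, PowerSeries.constantCoeff_mk, Polynomial.constantCoeff_coe, length_component_zero]
    at this
  exact this.symm

theorem map_intCast_eq_sum (h : ℤ[X]) : h.map (Int.castRingHom ℚ) =
    ∑ k ∈ Finset.range (h.natDegree + 1), (h.coeff k : ℚ) • (X ^ k : ℚ[X]) := by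
  conv_lhs => rw [h.as_sum_range_C_mul_X_pow]
  simp [Polynomial.map_sum, Polynomial.smul_eq_C_mul]

theorem hilbertPoly_map_intCast (h : ℤ[X]) (d : ℕ) :
    hilbertPoly (h.map (Int.castRingHom ℚ)) d =
      ∑ k ∈ Finset.range (h.natDegree + 1), (h.coeff k : ℚ) • hilbertPoly (X ^ k : ℚ[X]) d := by
  rw [map_intCast_eq_sum]
  change hilbertPoly_linearMap ℚ d _ = _
  rw [map_sum]
  simp only [map_smul]
  rfl

/-- The coefficients are the normalized derivatives `h^(i)(1) / i!`, which are visibly integers in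
this form. -/
theorem isCoefficientSequence_hilbertPoly (h : ℤ[X]) (d : ℕ) :
    IsCoefficientSequence d (hilbertPoly (h.map (Int.castRingHom ℚ)) d)
      (fun i => ∑ k ∈ Finset.range (h.natDegree + 1), h.coeff k * (k.choose i : ℤ)) := by
  rw [IsCoefficientSequence, hilbertPoly_map_intCast]
  simp only [hilbertPoly_X_pow, Finset.smul_sum]
  rw [Finset.sum_comm, Finset.sum_range]
  refine Finset.sum_congr rfl fun i _ => ?_
  push_cast
  rw [Finset.mul_sum, Finset.sum_smul]
  refine Finset.sum_congr rfl fun k _ => ?_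
  rw [smul_smul]
  congr 1
  ring

/-- Each monomial of `h` contributes the same binomial to `P` and `H`, except that `H` drops it for
`n < k`; only that tail survives in the difference. -/
theorem IsNumerator.defect_eq {e : ℕ} (hh : IsNumerator I₁ I₂ (e + 1) h) :
    defect I₁ I₂ = fun n => ∑ k ∈ Finset.range (h.natDegree + 1),
      (h.coeff k : ℚ) * binomialTail e k n := by
  ext n
  have hP : (hilbertPolynomial I₁ I₂).eval (n : ℚ) = ∑ k ∈ Finset.range (h.natDegree + 1),
      (h.coeff k : ℚ) * (preHilbertPoly ℚ e 0).eval ((n : ℚ) - k) := by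
    rw [hh.isHilbertPolynomial.hilbertPolynomial_eq, hilbertPoly_map_intCast]
    simp only [eval_finsetSum, hilbertPoly_X_pow_succ, eval_smul, smul_eq_mul]
    exact Finset.sum_congr rfl fun k _ => by rw [preHilbertPoly_eval_sub]
  have hH : (hilbertFunction I₁ I₂ n : ℚ) = ∑ k ∈ Finset.range (h.natDegree + 1),
      (h.coeff k : ℚ) * if (k : ℤ) ≤ n then (preHilbertPoly ℚ e 0).eval ((n : ℚ) - k) else 0 := by
    rcases lt_or_ge n 0 with hn | hn
    · rw [hilbertFunction_of_neg hn, Nat.cast_zero, eq_comm]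
      refine Finset.sum_eq_zero fun k _ => ?_
      rw [if_neg (by omega), mul_zero]
    · lift n to ℕ using hn
      rw [hh.hilbertFunction_eq, map_intCast_eq_sum, ← coeToPowerSeries.ringHom_apply, map_sum,
        Finset.sum_mul, map_sum]
      refine Finset.sum_congr rfl fun k _ => ?_
      rw [coeToPowerSeries.ringHom_apply, Polynomial.coe_smul, Polynomial.coe_pow,
        Polynomial.coe_X, smul_mul_assoc, map_smul, smul_eq_mul, PowerSeries.coeff_X_pow_mul',
        PowerSeries.invOneSubPow_val_succ_eq_mk_add_choose]
      simp only [Nat.cast_le]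
      split_ifs with hk
      · rw [PowerSeries.coeff_mk, Int.cast_natCast, ← Nat.cast_sub hk,
          preHilbertPoly_eq_choose_sub_add ℚ e (Nat.zero_le _), Nat.sub_zero, add_comm e]
      · rfl
  rw [defect, hP, hH, ← Finset.sum_sub_distrib]
  refine Finset.sum_congr rfl fun k _ => ?_
  rw [← mul_sub, binomialTail]
  congr 1
  by_cases hk : n < k
  · rw [if_neg (not_le.2 hk), if_pos hk, sub_zero]
  · rw [if_pos (not_lt.1 hk), if_neg hk, sub_self]

theorem IsNumerator.Δ_iterate_defect {e : ℕ} (hh : IsNumerator I₁ I₂ (e + 1) h) (n : ℤ) :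
    Δ^[e] (defect I₁ I₂) n = ∑ k ∈ Finset.range (h.natDegree + 1),
      (h.coeff k : ℚ) * if n < k then 1 else 0 := by
  rw [hh.defect_eq, Δ_iterate_sum]
  simp only [Δ_iterate_binomialTail]

theorem IsNumerator.hasSum_choose (hh : IsNumerator I₁ I₂ d h) {i : ℕ} (hi : 1 ≤ i) (hid : i < d) :
    HasSum (fun n : {n : ℕ // i - 1 ≤ n} =>
      ((n : ℕ).choose (i - 1) : ℚ) * (Δ^[d - 1] (defect I₁ I₂)) ((n : ℕ) : ℤ))
      (∑ k ∈ Finset.range (h.natDegree + 1), (h.coeff k : ℚ) * (k.choose i : ℚ)) := by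
  obtain ⟨e, rfl⟩ : ∃ e, d = e + 1 := ⟨d - 1, by omega⟩
  simp only [Nat.add_sub_cancel, hh.Δ_iterate_defect]
  convert hasSum_mul_sum_ite_lt (i - 1) (fun n => (n.choose (i - 1) : ℚ))
    (fun k => (h.coeff k : ℚ)) (Finset.range (h.natDegree + 1)) using 4 with k
  rw [← Nat.cast_sum, sum_Ico_choose, Nat.sub_add_cancel hi]

theorem IsNumerator.hasSum_choose_pred (hh : IsNumerator I₁ I₂ d h) {i : ℕ} (hi : 1 ≤ i)
    (hid : i < d) :
    HasSum (fun n : {n : ℕ // i ≤ n} =>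
      (((n : ℕ) - 1).choose (i - 1) : ℚ) * (Δ^[d - 1] (defect I₁ I₂)) ((n : ℕ) : ℤ))
      ((-1) ^ i * ∑ j ∈ Finset.range (i + 1), (-1) ^ j *
        (∑ k ∈ Finset.range (h.natDegree + 1), (h.coeff k : ℚ) * (k.choose j : ℚ)) +
        (-1) ^ (i + 1) * ((Module.length R (R ⧸ I₁)).toNat : ℚ)) := by
  obtain ⟨e, rfl⟩ : ∃ e, d = e + 1 := ⟨d - 1, by omega⟩
  simp only [Nat.add_sub_cancel, hh.Δ_iterate_defect]
  convert hasSum_mul_sum_ite_lt i (fun n => ((n - 1).choose (i - 1) : ℚ))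
    (fun k => (h.coeff k : ℚ)) (Finset.range (h.natDegree + 1)) using 1
  simp only [sum_Ico_choose_pred hi, mul_add, Finset.sum_add_distrib]
  congr 1
  · simp only [Finset.mul_sum]
    rw [Finset.sum_comm]
    refine Finset.sum_congr rfl fun k _ => Finset.sum_congr rfl fun j _ => ?_
    ring
  -- The correction terms at `k = 0` add up to `h_0`, the length in degree zero.
  · have h0 : ((Module.length R (R ⧸ I₁)).toNat : ℚ) = (h.coeff 0 : ℚ) := by
      rw [hh.coeff_zero_eq, Int.cast_natCast]
    rw [h0, Finset.sum_eq_single 0]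
    · simp [mul_comm]
    · intro k _ hk
      simp [hk]
    · simp

end Hilbert

theorem sum_fin_Iic {d : ℕ} (i : Fin d) (F : ℕ → ℚ) :
    ∑ j ∈ Finset.Iic i, F j = ∑ j ∈ Finset.range ((i : ℕ) + 1), F j := by
  rw [Nat.range_succ_eq_Iic, ← Fin.map_valEmbedding_Iic, Finset.sum_map]
  rfl

end FiberCone

theorem mainTheorem9 {R : Type*} [CommRing R] [IsLocalRing R] [IsNoetherianRing R]
    (hCM : FiberCone.IsCohenMacaulayLocal R) (d : ℕ) (hd : ringKrullDim R = d)
    (I₁ I₂ : Ideal R) (hI₁ : I₁.radical = IsLocalRing.maximalIdeal R)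
    (hI₂ : I₂.radical = IsLocalRing.maximalIdeal R) :
    -- the lengths are finite, and the Hilbert polynomial and coefficients are what they should be
    Module.length R (R ⧸ I₁) ≠ ⊤ ∧
    (∀ n : ℕ, Module.length R (FiberCone.component I₁ I₂ n) ≠ ⊤) ∧
    FiberCone.IsHilbertPolynomial I₁ I₂ (FiberCone.hilbertPolynomial I₁ I₂) ∧
    FiberCone.IsCoefficientSequence d (FiberCone.hilbertPolynomial I₁ I₂)
      (FiberCone.hilbertCoefficient d I₁ I₂) ∧
    -- the two formulas, for `1 ≤ i ≤ d - 1`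
    ∀ i : Fin d, 1 ≤ (i : ℕ) →
      HasSum
        (fun n : {n : ℕ // (i : ℕ) - 1 ≤ n} =>
          (((n : ℕ).choose ((i : ℕ) - 1) : ℕ) : ℚ) *
            (FiberCone.Δ^[d - 1] (FiberCone.defect I₁ I₂)) ((n : ℕ) : ℤ))
        (FiberCone.hilbertCoefficient d I₁ I₂ i : ℚ) ∧
      HasSum
        (fun n : {n : ℕ // (i : ℕ) ≤ n} =>
          ((((n : ℕ) - 1).choose ((i : ℕ) - 1) : ℕ) : ℚ) *
            (FiberCone.Δ^[d - 1] (FiberCone.defect I₁ I₂)) ((n : ℕ) : ℤ))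
        ((-1) ^ (i : ℕ) *
            ∑ j ∈ Finset.Iic i, (-1) ^ (j : ℕ) * (FiberCone.hilbertCoefficient d I₁ I₂ j : ℚ) +
          (-1) ^ ((i : ℕ) + 1) * ((Module.length R (R ⧸ I₁)).toNat : ℚ)) := by

  have hfin := FiberCone.length_component_ne_top hI₁ hI₂
  obtain ⟨C, s, hs, hsum⟩ := FiberCone.exists_sum_length_component_le hd hI₁ hI₂
  obtain ⟨h, hh⟩ := FiberCone.exists_mul_eq_of_sum_le
    (FiberCone.hasRationalSeries_length_component I₁ I₂ hfin) hs hsum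
  replace hh : FiberCone.IsNumerator I₁ I₂ d h := hh
  have hP := hh.isHilbertPolynomial
  have hc := FiberCone.isCoefficientSequence_hilbertPoly h d
  rw [← hP.hilbertPolynomial_eq] at hc hP
  refine ⟨FiberCone.length_component_zero I₁ I₂ ▸ hfin 0, hfin, hP, ?_, fun i hi => ?_⟩
  · rwa [hc.hilbertCoefficient_eq]
  rw [hc.hilbertCoefficient_eq]
  push_cast
  refine ⟨hh.hasSum_choose hi i.2, ?_⟩
  rw [FiberCone.sum_fin_Iic i (fun j => (-1) ^ j *
    ∑ k ∈ Finset.range (h.natDegree + 1), (h.coeff k : ℚ) * (k.choose j : ℚ))]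
  exact hh.hasSum_choose_pred hi i.2
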